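/- For a commutative semigroup $(G,+)$ and a set of noncommuting variables $Z$, let $G[Z]$ denote the additive semigroup of formal polynomials in the variables $Z$ with coefficients from $G$: finite formal sums of monomials $c\,z_1z_2\cdots z_k$ with $c\in G$, $k\ge 0$ and $z_1,\dots,z_k\in Z$, where $c\,w+c'\,w=(c+c')\,w$ for every word $w$ in the variables. The empty sum, the zero polynomial $0$, is included; if $G$ has a zero $0_G$, then $0_G\,w=0$. A polynomial has no constant term if the empty word does not occur in it (that is, occurs with coefficient zero). A monomial with coefficient $c$ is evaluated at sums of variables by expanding, so that, e.g., $c\,x_1x_2$ at $x_i=\sum_{j\in\gamma}y_{i,j}$ is $\sum_{j,k\in\gamma}c\,y_{1,j}y_{2,k}$. **Proposition 7.3.** Let $r,q,n\in\mathbb N$, let $G$ be a commutative semigroup and let $p_1,\dots,p_q\in G[x_1,\dots,x_n]$ be polynomials without constant terms. There exist $N\in\mathbb N$ and a finite set $\mathcal Q\subset G[y_{1,1},\dots,y_{1,N},y_{2,1},\dots,y_{2,N},\dots,y_{n,1},\dots,y_{n,N}]$ of polynomials without constant terms such that for any $r$-coloring of $\mathcal Q$ there exist a nonempty $\gamma\subseteq\{1,\dots,N\}$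 and a polynomial $h\in\mathcal Q$ for which the polynomials $$h(y_{1,1},\dots,y_{n,N})+p_t\Bigl(\sum_{j\in\gamma}y_{1,j},\dots,\sum_{j\in\gamma}y_{n,j}\Bigr),\qquad t=1,\dots,q,$$ are all in $\mathcal Q$ and have the same color. -/

import Mathlib

noncomputable section

namespace NCPolynomial

/-- An element `x` of `G` with a zero adjoined is neutral if adding it changes no element of `G`.
The adjoined zero is always neutral; `(g : WithZero G)` is neutral iff `g` is a zero of `G`. -/
def IsNeutral {G : Type*} [AddCommSemigroup G] (x : WithZero G) : Prop :=
  ∀ g : G, x + (g : WithZero G) = (g : WithZero G)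

/-- The congruence on `WithZero G` identifying the adjoined zero with the zero of `G`,
if `G` happens to have one (and the trivial congruence otherwise). -/
def zeroCon (G : Type*) [AddCommSemigroup G] : AddCon (WithZero G) where
  r x y := x = y ∨ (IsNeutral x ∧ IsNeutral y)
  iseqv := by
    refine ⟨fun x => Or.inl rfl, ?_, ?_⟩
    · rintro x y (h | ⟨h, h'⟩)
      · exact Or.inl h.symm
      · exact Or.inr ⟨h', h⟩
    · rintro x y z (rfl | ⟨h, h'⟩) (rfl | ⟨k, k'⟩)
      · exact Or.inl rfl
      · exact Or.inr ⟨k, k'⟩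
      · exact Or.inr ⟨h, h'⟩
      · exact Or.inr ⟨h, k'⟩
  add' := by
    have key : ∀ a b c : WithZero G, IsNeutral b → IsNeutral c →
        a + b = a + c ∨ (IsNeutral (a + b) ∧ IsNeutral (a + c)) := by
      intro a b c hb hc
      induction a using WithZero.recZeroCoe with
      | zero => right; simpa using ⟨hb, hc⟩
      | coe g => left; rw [add_comm _ b, add_comm _ c, hb g, hc g]
    rintro w x y z (rfl | ⟨h, h'⟩) (rfl | ⟨k, k'⟩)
    · exact Or.inl rfl
    · exact key w y z k k'
    · rw [add_comm w, add_comm x]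
      exact key y w x h h'
    · right
      constructor
      · intro g; rw [add_assoc, k g, h g]
      · intro g; rw [add_assoc, k' g, h' g]

/-- The coefficients of formal polynomials over a commutative semigroup `G`: the elements of `G`,
together with a zero (the coefficient of an absent monomial), adjoined if `G` has none. -/
abbrev Coeff (G : Type*) [AddCommSemigroup G] : Type _ := (zeroCon G).Quotient

/-- The inclusion of `G` in `Coeff G`. -/
def Coeff.of {G : Type*} [AddCommSemigroup G] (g : G) : Coeff G :=
  ((g : WithZero G) : (zeroCon G).Quotient)

theorem Coeff.of_add {G : Type*} [AddCommSemigroup G] (g h : G) :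
    Coeff.of (g + h) = Coeff.of g + Coeff.of h := rfl

theorem Coeff.of_injective {G : Type*} [AddCommSemigroup G] :
    Function.Injective (Coeff.of : G → Coeff G) := by
  intro g h e
  rcases (AddCon.eq (zeroCon G)).1 e with e | ⟨hg, hh⟩
  · exact WithZero.coe_injective e
  · have h1 : g + h = h := WithZero.coe_injective (hg h)
    have h2 : h + g = g := WithZero.coe_injective (hh g)
    rw [← h2, add_comm, h1]

theorem Coeff.of_eq_zero_iff {G : Type*} [AddCommSemigroup G] (g : G) :
    Coeff.of g = 0 ↔ ∀ h : G, g + h = h := by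
  refine ⟨fun e h => ?_, fun H => (AddCon.eq (zeroCon G)).2 (Or.inr ⟨fun h => ?_, fun h => ?_⟩)⟩
  · rcases (AddCon.eq (zeroCon G)).1 e with e | ⟨hg, -⟩
    · exact absurd e (WithZero.coe_ne_zero)
    · exact WithZero.coe_injective (hg h)
  · exact congrArg _ (H h)
  · exact zero_add _

theorem Coeff.eq_zero_or_exists_of {G : Type*} [AddCommSemigroup G] (c : Coeff G) :
    c = 0 ∨ ∃ g : G, c = Coeff.of g := by
  induction c using AddCon.induction_on with
  | H x =>
    induction x using WithZero.recZeroCoe with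
    | zero => exact Or.inl rfl
    | coe g => exact Or.inr ⟨g, rfl⟩

end NCPolynomial

open NCPolynomial in
/-- The additive semigroup `G[σ]` of formal polynomials in noncommuting variables indexed by `σ`
with coefficients from the commutative semigroup `G`: finitely supported families of coefficients
indexed by the words in the variables, with coefficientwise addition. -/
abbrev NCPolynomial (G : Type*) [AddCommSemigroup G] (σ : Type*) : Type _ :=
  FreeMonoid σ →₀ Coeff G

namespace NCPolynomial

/-- A polynomial has no constant term if the coefficient of the empty word is zero. -/
def NoConstantTerm {G : Type*} [AddCommSemigroup G] {σ : Type*} (p : NCPolynomial G σ) : Prop :=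
  p (1 : FreeMonoid σ) = 0

/-- Polynomials in noncommuting variables indexed by `τ` with natural number coefficients;
these can be substituted for the variables of a polynomial over any commutative semigroup. -/
abbrev NatPoly (τ : Type*) : Type _ := MonoidAlgebra ℕ (FreeMonoid τ)

/-- The variable `y_i`, as a polynomial with natural number coefficients. -/
def natVar {τ : Type*} (i : τ) : NatPoly τ := MonoidAlgebra.of ℕ (FreeMonoid τ) (FreeMonoid.of i)

/-- For `c` a coefficient and `f = ∑ m_u u` with `m_u` natural numbers,
the polynomial `c f = ∑ (m_u c) u`. -/
def coeffMul {G : Type*} [AddCommSemigroup G] {τ : Type*} (c : Coeff G) (f : NatPoly τ) :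
    NCPolynomial G τ :=
  ∑ u ∈ f.coeff.support, Finsupp.single u (f.coeff u • c)

/-- Substitution `p(f_i : i ∈ σ)`: every monomial `c x_{i_1} ⋯ x_{i_k}` of `p` is replaced by
`c f_{i_1} ⋯ f_{i_k}`. -/
def subst {G : Type*} [AddCommSemigroup G] {σ τ : Type*} (p : NCPolynomial G σ)
    (f : σ → NatPoly τ) : NCPolynomial G τ :=
  ∑ w ∈ p.support, coeffMul (p w) (FreeMonoid.lift f w)

end NCPolynomial

end

-- Over an abelian group the result is a polynomial van der Waerden theorem,
-- `isRecurrent_of_mem_polyMaps`. Colour focusing (`exists_focused`) reduces a system `S` of maps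
-- vanishing at zero to the systems of all `v ↦ p (u + v) - p u - p₁ v` with `p ∈ S` and `u` in a
-- finite set. If `p₁` has least degree in `S`, these have smaller weight: the numbers of distinct
-- leading parts in each degree, compared from the top degree down. Well-founded induction on the
-- weight finishes.
--
-- Coefficients in `G` cannot be subtracted, so the theorem is applied to integer multiplicities,
-- with a separate coordinate for each pair of an index `t` and a word. The finitely many base
-- points are shifted by one vector `b` to become nonnegative; `realize` then turns multiplicities
-- into multiples of the actual coefficients. It is additive where needed (`realize_add`), so `a + P
-- t v` is carried to `h` plus the substituted `p t`.

universe u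

/-! ### Polynomial maps between commutative monoids and abelian groups. -/

namespace PolynomialMap

variable {V A : Type*} [AddCommMonoid V] [AddCommGroup A]

/-- The difference operator `p ↦ (v ↦ p (u + v) - p u - p v)`. -/
def diff (u : V) : (V → A) →+ (V → A) where
  toFun p v := p (u + v) - p u - p v
  map_zero' := by ext; simp
  map_add' p q := by ext; simp; abel

@[simp] theorem diff_apply (u : V) (p : V → A) (v : V) :
    diff u p v = p (u + v) - p u - p v := rfl

/-- The maps `V → A` that vanish at zero and are polynomial of degree at most `d`. -/
def polyMaps (V A : Type*) [AddCommMonoid V] [AddCommGroup A] : ℕ → AddSubgroup (V → A)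
  | 0 => ⊥
  | d + 1 => ⨅ u : V, (polyMaps V A d).comap (diff u)

theorem mem_polyMaps_zero {p : V → A} : p ∈ polyMaps V A 0 ↔ p = 0 := AddSubgroup.mem_bot

theorem mem_polyMaps_succ {d : ℕ} {p : V → A} :
    p ∈ polyMaps V A (d + 1) ↔ ∀ u, diff u p ∈ polyMaps V A d := by
  simp [polyMaps, AddSubgroup.mem_iInf]

theorem polyMaps_mono : Monotone (polyMaps V A) := by
  refine monotone_nat_of_le_succ fun d => ?_
  induction d with
  | zero => exact bot_le
  | succ d ih =>
    intro p hp
    rw [mem_polyMaps_succ] at hp ⊢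
    exact fun u => ih (hp u)

theorem map_zero_of_mem {d : ℕ} {p : V → A} (hp : p ∈ polyMaps V A d) : p 0 = 0 := by
  induction d generalizing p with
  | zero => rw [mem_polyMaps_zero.1 hp]; rfl
  | succ d ih => simpa using ih (mem_polyMaps_succ.1 hp 0)

theorem comp_mem_polyMaps {B : Type*} [AddCommGroup B] (g : A →+ B) {d : ℕ} {p : V → A}
    (hp : p ∈ polyMaps V A d) : (fun v => g (p v)) ∈ polyMaps V B d := by
  induction d generalizing p with
  | zero => rw [mem_polyMaps_zero] at hp ⊢; ext; simp [hp]
  | succ d ih =>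
    rw [mem_polyMaps_succ] at hp ⊢
    intro u
    convert ih (hp u) using 1
    ext; simp

theorem addMonoidHom_mem_polyMaps (g : V →+ A) : (g : V → A) ∈ polyMaps V A 1 := by
  rw [mem_polyMaps_succ]
  intro u
  rw [mem_polyMaps_zero]
  ext; simp

/-- Product rule: with `Δ = diff u p v`, the difference of `l * p` is `l u * (Δ + p v) + l v * Δ + l
v * p u`, where only the middle term needs induction. -/
theorem mul_mem_polyMaps {R : Type*} [Ring R] (l : V →+ R) {d : ℕ} {p : V → R}
    (hp : p ∈ polyMaps V R d) : (fun v => l v * p v) ∈ polyMaps V R (d + 1) := by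
  induction d generalizing p with
  | zero =>
    rw [mem_polyMaps_zero] at hp
    simp only [hp, Pi.zero_apply, mul_zero]
    exact zero_mem _
  | succ d ih =>
    rw [mem_polyMaps_succ]
    intro u
    have hu := mem_polyMaps_succ.1 hp u
    have h1 := comp_mem_polyMaps (AddMonoidHom.mulLeft (l u))
      (add_mem (polyMaps_mono d.le_succ hu) hp)
    have h2 := ih hu
    have h3 := polyMaps_mono (Nat.le_add_left 1 d)
      (addMonoidHom_mem_polyMaps ((AddMonoidHom.mulRight (p u)).comp l))
    convert add_mem (add_mem h1 h2) h3 using 1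
    ext v
    simp [add_mul, mul_sub]
    abel

/-- Every finite colouring of `A` admits `a` and a finite sum `v` of terms of a given sequence
such that `a` and all `a + p v` with `p ∈ S` have the same colour, with uniform bounds. -/
def IsRecurrent {V A : Type u} [AddCommMonoid V] [AddCommGroup A] (S : Finset (V → A)) : Prop :=
  ∀ (κ : Type u) [Finite κ] (e : ℕ → V), ∃ (N : ℕ) (Q : Finset A), ∀ χ : A → κ,
    ∃ a ∈ Q, ∃ γ ⊆ Finset.range N, γ.Nonempty ∧ ∀ p ∈ S, χ (a + p (∑ j ∈ γ, e j)) = χ a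

/-! ### Colour focusing. -/

section Focusing

variable {V A : Type u} [AddCommMonoid V] [AddCommGroup A]

open Classical in
/-- Colour focusing: one finds either a monochromatic configuration, or a point `a` together with
`s` monochromatic configurations based at `a` with distinct colours different from that of `a`. -/
theorem exists_focused {S : Finset (V → A)} (p₁ : V → A) (h0 : ∀ p ∈ S, p 0 = 0)
    (h : ∀ U : Finset V,
      IsRecurrent ((S ×ˢ U).image fun x => x.1 + diff x.2 x.1 - p₁))
    (κ : Type u) [Finite κ] (e : ℕ → V) (s : ℕ) :
    ∃ (N : ℕ) (Q : Finset A), ∀ χ : A → κ,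
      (∃ a ∈ Q, ∃ γ ⊆ Finset.range N, γ.Nonempty ∧ ∀ p ∈ S, χ (a + p (∑ j ∈ γ, e j)) = χ a) ∨
      ∃ a ∈ Q, ∃ C : Finset κ, C.card = s ∧ χ a ∉ C ∧ ∀ c ∈ C,
        ∃ γ ⊆ Finset.range N, γ.Nonempty ∧ ∀ p ∈ S, χ (a + p (∑ j ∈ γ, e j)) = c := by
  induction s with
  | zero => exact ⟨0, {0}, fun χ => Or.inr ⟨0, by simp, ∅, by simp⟩⟩
  | succ s ih =>
    obtain ⟨N, Q, hQ⟩ := ih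
    set σ : Finset ℕ → V := fun γ => ∑ j ∈ γ, e j with hσ
    let U : Finset V := (Finset.range N).powerset.image σ
    let B : Finset A := Q ∪ (Q ×ˢ (S ×ˢ U)).image fun x => x.1 + x.2.1 x.2.2
    -- The colour of `a'` is the whole pattern of `χ` on `a' + B`, so one recurrence handles all of
    -- `B` at once. The shifted sequence keeps the new index set disjoint from the old ones.
    obtain ⟨N', Q', hQ'⟩ := h U (B → κ) (fun j => e (N + j))
    let σ' : Finset ℕ → V := fun γ => ∑ j ∈ γ, e (N + j)
    have hU : ∀ γ ⊆ Finset.range N, σ γ ∈ U := fun γ hγ =>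
      Finset.mem_image_of_mem _ (Finset.mem_powerset.2 hγ)
    refine ⟨N + N', (Q' ×ˢ Q).image (fun x => x.1 + x.2) ∪
      (Q' ×ˢ (Q ×ˢ (Finset.range N').powerset)).image
        (fun x => x.1 + x.2.1 - p₁ (σ' x.2.2)), fun χ => ?_⟩
    obtain ⟨a', ha', δ, hδ, hδ0, hmono⟩ := hQ' fun a b => χ (a + b)
    have key : ∀ p ∈ S, ∀ u ∈ U, ∀ b ∈ B,
        χ (a' + (p (σ' δ) + diff u p (σ' δ) - p₁ (σ' δ)) + b) = χ (a' + b) := by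
      intro p hp u hu b hb
      have := hmono _ (Finset.mem_image_of_mem (fun x => x.1 + diff x.2 x.1 - p₁)
        (Finset.mk_mem_product hp hu))
      exact congrFun this ⟨b, hb⟩
    let δ' : Finset ℕ := δ.map (addLeftEmbedding N)
    have hδ' : σ δ' = σ' δ := by simp [σ, σ', δ']
    have hδr : δ' ⊆ Finset.range (N + N') := by
      intro j hj
      obtain ⟨i, hi, rfl⟩ := Finset.mem_map.1 hj
      have := Finset.mem_range.1 (hδ hi)
      simpa using this
    have hN : Finset.range N ⊆ Finset.range (N + N') := Finset.range_mono (by omega)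
    rcases hQ fun b => χ (a' + b) with ⟨b, hb, γ, hγ, hγ0, hc⟩ | ⟨b, hb, C, hC, hbC, hc⟩
    · refine Or.inl ⟨a' + b, Finset.mem_union_left _ (Finset.mem_image.2 ⟨(a', b), by simp [*]⟩),
        γ, hγ.trans hN, hγ0, fun p hp => ?_⟩
      rw [add_assoc]
      exact hc p hp
    -- Subtracting `p₁ (σ' δ)` makes `a + p (σ γ + σ' δ)` equal to `a' + b + p (σ γ)` plus the
    -- derived map for `u = σ γ` at `σ' δ`. Old colours thus persist, and `u = 0` adds the colour of
    -- the old base point.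
    set a := a' + b - p₁ (σ' δ) with ha
    have haQ : a ∈ (Q' ×ˢ Q).image (fun x => x.1 + x.2) ∪
      (Q' ×ˢ (Q ×ˢ (Finset.range N').powerset)).image
        (fun x => x.1 + x.2.1 - p₁ (σ' x.2.2)) :=
      Finset.mem_union_right _ (Finset.mem_image.2 ⟨(a', b, δ), by simp [*]⟩)
    have hfoc : ∀ c ∈ insert (χ (a' + b)) C, ∃ γ ⊆ Finset.range (N + N'), γ.Nonempty ∧
        ∀ p ∈ S, χ (a + p (σ γ)) = c := by
      intro c hcC
      rcases Finset.mem_insert.1 hcC with rfl | hcC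
      · refine ⟨δ', hδr, hδ0.map, fun p hp => ?_⟩
        have h00 : (0 : V) ∈ U := by simpa [σ] using hU ∅ (by simp)
        rw [← key p hp 0 h00 b (Finset.mem_union_left _ hb), hδ', ha]
        congr 1
        simp [h0 p hp]
        abel
      · obtain ⟨γ, hγ, hγ0, hγc⟩ := hc c hcC
        refine ⟨γ ∪ δ', Finset.union_subset (hγ.trans hN) hδr, hγ0.mono Finset.subset_union_left,
          fun p hp => ?_⟩
        have hdisj : Disjoint γ δ' := by
          rw [Finset.disjoint_left]
          intro j hj hj'
          obtain ⟨i, hi, rfl⟩ := Finset.mem_map.1 hj'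
          have := Finset.mem_range.1 (hγ hj)
          simp at this
        have hun : σ (γ ∪ δ') = σ γ + σ' δ := by
          rw [← hδ']; exact Finset.sum_union hdisj
        rw [← hγc p hp, ← key p hp (σ γ) (hU γ hγ) (b + p (σ γ)) (Finset.mem_union_right _
          (Finset.mem_image.2 ⟨(b, p, σ γ), by simp [hb, hp, hU γ hγ]⟩)), hun, ha]
        congr 1
        simp
        abel
    by_cases hain : χ a ∈ insert (χ (a' + b)) C
    · obtain ⟨γ, hγ, hγ0, hγc⟩ := hfoc _ hain
      exact Or.inl ⟨a, haQ, γ, hγ, hγ0, hγc⟩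
    · refine Or.inr ⟨a, haQ, insert (χ (a' + b)) C, ?_, hain, hfoc⟩
      rw [Finset.card_insert_of_notMem hbC, hC]

-- Focusing on as many colours as there are leaves no colour for the base point.
open Classical in
theorem IsRecurrent.of_diff {S : Finset (V → A)} (p₁ : V → A) (h0 : ∀ p ∈ S, p 0 = 0)
    (h : ∀ U : Finset V,
      IsRecurrent ((S ×ˢ U).image fun x => x.1 + diff x.2 x.1 - p₁)) :
    IsRecurrent S := by
  intro κ _ e
  have := Fintype.ofFinite κ
  obtain ⟨N, Q, hQ⟩ := exists_focused p₁ h0 h κ e (Fintype.card κ)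
  refine ⟨N, Q, fun χ => (hQ χ).resolve_right ?_⟩
  rintro ⟨a, -, C, hC, haC, -⟩
  rw [(Finset.card_eq_iff_eq_univ C).1 hC] at haC
  exact haC (Finset.mem_univ _)

-- The zero map imposes no condition. It has no leading part and does occur among derived maps (`p =
-- p₁`, `u = 0`), so it is discarded before weights are compared.
open Classical in
theorem IsRecurrent.of_erase_zero {S : Finset (V → A)} (h : IsRecurrent (S.erase 0)) :
    IsRecurrent S := by
  intro κ _ e
  obtain ⟨N, Q, hQ⟩ := h κ e
  refine ⟨N, Q, fun χ => ?_⟩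
  obtain ⟨a, ha, γ, hγ, hγ0, hc⟩ := hQ χ
  refine ⟨a, ha, γ, hγ, hγ0, fun p hp => ?_⟩
  by_cases hp0 : p = 0
  · simp [hp0]
  · exact hc p (Finset.mem_erase.2 ⟨hp0, hp⟩)

theorem isRecurrent_empty : IsRecurrent (∅ : Finset (V → A)) := fun κ _ e =>
  ⟨1, {0}, fun χ => ⟨0, by simp, {0}, by simp, by simp, by simp⟩⟩

/-! ### Induction on the weight of a system. -/

open Classical in
/-- The leading parts of the members of `S` of degree `i + 1`. -/
noncomputable def leads (S : Finset (V → A)) (i : ℕ) : Finset ((V → A) ⧸ polyMaps V A i) :=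
  (S.filter fun p => p ∈ polyMaps V A (i + 1) ∧ p ∉ polyMaps V A i).image
    (QuotientAddGroup.mk' (polyMaps V A i))

theorem mem_leads {S : Finset (V → A)} {i : ℕ} {x : (V → A) ⧸ polyMaps V A i} :
    x ∈ leads S i ↔ ∃ p ∈ S, p ∈ polyMaps V A (i + 1) ∧ p ∉ polyMaps V A i ∧
      QuotientAddGroup.mk' (polyMaps V A i) p = x := by
  classical
  simp [leads, and_assoc]

/-- The leading part of `p + diff u p - p₁` comes from that of `p` if the degree is at least that
of `p₁` and the degree of `p` is not smaller. -/
theorem lead_of_diff {D k i : ℕ} {p p₁ : V → A} (u : V) (hp : p ∈ polyMaps V A D)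
    (hpk : p ∉ polyMaps V A k) (hp₁ : p₁ ∈ polyMaps V A (k + 1)) (hki : k ≤ i)
    (hf : p + diff u p - p₁ ∈ polyMaps V A (i + 1)) (hf' : p + diff u p - p₁ ∉ polyMaps V A i) :
    p ∈ polyMaps V A (i + 1) ∧ p ∉ polyMaps V A i ∧ diff u p ∈ polyMaps V A i := by
  have hex : ∃ j, p ∈ polyMaps V A (j + 1) := ⟨D, polyMaps_mono D.le_succ hp⟩
  classical
  set j := Nat.find hex with hj
  have h1 : p ∈ polyMaps V A (j + 1) := Nat.find_spec hex
  have h2 : p ∉ polyMaps V A j := by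
    rcases Nat.eq_zero_or_pos j with h | h
    · rw [h]
      exact fun h' => hpk (polyMaps_mono (Nat.zero_le k) h')
    · have := Nat.find_min hex (m := j - 1) (by omega)
      rwa [Nat.sub_add_cancel h] at this
  have hd : diff u p ∈ polyMaps V A j := mem_polyMaps_succ.1 h1 u
  have hkj : k ≤ j := by
    by_contra hlt
    exact hpk (polyMaps_mono (by omega) h1)
  -- Here `j + 1` is the exact degree of `p`. The correction `diff u p` has lower degree, so a
  -- mismatch with `i` would make `p` or the derived map drop in degree.
  have hji : j = i := by
    rcases lt_trichotomy i j with hij | hij | hij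
    · refine absurd ?_ h2
      have := add_mem (sub_mem (polyMaps_mono (show i + 1 ≤ j by omega) hf) hd)
        (polyMaps_mono (show k + 1 ≤ j by omega) hp₁)
      convert this using 1
      abel
    · exact hij.symm
    · refine absurd ?_ hf'
      exact sub_mem (add_mem (polyMaps_mono (show j + 1 ≤ i by omega) h1)
        (polyMaps_mono hij.le hd)) (polyMaps_mono (show k + 1 ≤ i by omega) hp₁)
  rw [hji] at h1 h2 hd
  exact ⟨h1, h2, hd⟩

open Classical in
theorem isRecurrent_of_mem_polyMaps {D : ℕ} (S : Finset (V → A))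
    (hS : ∀ p ∈ S, p ∈ polyMaps V A D) : IsRecurrent S := by
  suffices H : ∀ w : Fin D → ℕ, ∀ S : Finset (V → A), (∀ p ∈ S, p ∈ polyMaps V A D ∧ p ≠ 0) →
      (fun i : Fin D => (leads S i).card) = w → IsRecurrent S from
    IsRecurrent.of_erase_zero (H _ _ (fun p hp => ⟨hS p (Finset.mem_of_mem_erase hp),
      Finset.ne_of_mem_erase hp⟩) rfl)
  clear hS S
  intro w
  -- The reversed order on indices makes the highest degree the most significant.
  have wf : WellFounded (Pi.Lex (· > ·) (fun {_ : Fin D} => ((· < ·) : ℕ → ℕ → Prop))) :=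
    Pi.Lex.wellFounded _ fun _ => wellFounded_lt
  induction w using wf.induction with
  | _ w ih =>
  rintro S hS rfl
  rcases S.eq_empty_or_nonempty with rfl | ⟨p₀, hp₀⟩
  · exact isRecurrent_empty
  have hex : ∃ k, ∃ p ∈ S, p ∈ polyMaps V A (k + 1) :=
    ⟨D, p₀, hp₀, polyMaps_mono D.le_succ (hS p₀ hp₀).1⟩
  set k := Nat.find hex with hk
  obtain ⟨p₁, hp₁S, hp₁⟩ := Nat.find_spec hex
  rw [← hk] at hp₁
  have hmin : ∀ p ∈ S, p ∉ polyMaps V A k := by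
    intro p hp hpk
    rcases Nat.eq_zero_or_pos k with h | h
    · rw [h, mem_polyMaps_zero] at hpk
      exact (hS p hp).2 hpk
    · refine Nat.find_min hex (m := k - 1) (by omega) ⟨p, hp, ?_⟩
      rwa [Nat.sub_add_cancel h]
  have hkD : k < D := by
    by_contra h
    exact hmin p₁ hp₁S (polyMaps_mono (by omega) (hS p₁ hp₁S).1)
  refine IsRecurrent.of_diff p₁ (fun p hp => map_zero_of_mem (hS p hp).1) fun U => ?_
  set S' := ((S ×ˢ U).image fun x => x.1 + diff x.2 x.1 - p₁).erase 0 with hS'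
  have memS' : ∀ f ∈ S', ∃ p ∈ S, ∃ u, f = p + diff u p - p₁ ∧ f ≠ 0 := by
    intro f hf
    obtain ⟨hf0, hf⟩ := Finset.mem_erase.1 hf
    obtain ⟨⟨p, u⟩, hpu, rfl⟩ := Finset.mem_image.1 hf
    exact ⟨p, (Finset.mem_product.1 hpu).1, u, rfl, hf0⟩
  -- Above the minimal degree both `diff u p` and `p₁` vanish modulo `polyMaps V A i`.
  have hle : ∀ i, k < i → leads S' i ⊆ leads S i := by
    intro i hi x hx
    obtain ⟨f, hf, hf1, hf2, rfl⟩ := mem_leads.1 hx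
    obtain ⟨p, hp, u, rfl, -⟩ := memS' f hf
    obtain ⟨h1, h2, h3⟩ := lead_of_diff u (hS p hp).1 (hmin p hp) hp₁ hi.le hf1 hf2
    refine mem_leads.2 ⟨p, hp, h1, h2, ?_⟩
    refine (QuotientAddGroup.eq).2 ?_
    convert sub_mem h3 (polyMaps_mono hi hp₁) using 1
    abel
  have hlt : (leads S' k).card < (leads S k).card := by
    set m := QuotientAddGroup.mk' (polyMaps V A k) with hm
    have hp₁m : m p₁ ∈ leads S k := mem_leads.2 ⟨p₁, hp₁S, hp₁, hmin p₁ hp₁S, rfl⟩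
    -- In the minimal degree leading parts are translated by that of `p₁`, whose own class becomes
    -- zero and is lost.
    have hsub : leads S' k ⊆ ((leads S k).erase (m p₁)).image fun x => x - m p₁ := by
      intro x hx
      obtain ⟨f, hf, hf1, hf2, rfl⟩ := mem_leads.1 hx
      obtain ⟨p, hp, u, rfl, -⟩ := memS' f hf
      obtain ⟨h1, h2, h3⟩ := lead_of_diff u (hS p hp).1 (hmin p hp) hp₁ le_rfl hf1 hf2
      have hu : m (diff u p) = 0 := (QuotientAddGroup.eq_zero_iff _).2 h3
      have hne : m (p + diff u p - p₁) ≠ 0 := fun h => hf2 ((QuotientAddGroup.eq_zero_iff _).1 h)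
      rw [map_sub, map_add, hu, add_zero] at hne
      refine Finset.mem_image.2 ⟨m p, Finset.mem_erase.2 ⟨sub_ne_zero.1 hne,
        mem_leads.2 ⟨p, hp, h1, h2, rfl⟩⟩, ?_⟩
      change m p - m p₁ = m (p + diff u p - p₁)
      rw [map_sub, map_add, hu, add_zero]
    exact (Finset.card_le_card hsub).trans_lt
      (Finset.card_image_le.trans_lt (Finset.card_erase_lt_of_mem hp₁m))
  have hS'D : ∀ f ∈ S', f ∈ polyMaps V A D ∧ f ≠ 0 := by
    intro f hf
    obtain ⟨p, hp, u, rfl, hf0⟩ := memS' f hf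
    exact ⟨sub_mem (add_mem (hS p hp).1 (mem_polyMaps_succ.1
      (polyMaps_mono D.le_succ (hS p hp).1) u)) (hS p₁ hp₁S).1, hf0⟩
  -- Among the indices above `k`, look for the top one where the weights differ.
  refine IsRecurrent.of_erase_zero (ih _ ?_ S' hS'D rfl)
  obtain ⟨i, hi, hmax⟩ := Finset.exists_max_image
    (Finset.univ.filter fun i : Fin D => (leads S' i).card ≠ (leads S i).card) id
    ⟨⟨k, hkD⟩, by simpa using hlt.ne⟩
  refine ⟨i, fun j hj => ?_, ?_⟩
  · by_contra hne
    exact absurd (hmax j (by simpa using hne)) (not_le.2 hj)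
  · have hik : k ≤ i := hmax ⟨k, hkD⟩ (by simpa using hlt.ne)
    rcases hik.eq_or_lt with h | h
    · change (leads S' i).card < (leads S i).card
      rw [← h]; exact hlt
    · exact lt_of_le_of_ne (Finset.card_le_card (hle i h)) (by simpa using hi)

end Focusing

end PolynomialMap

/-! ### Evaluation of words as a polynomial map. -/

namespace PolynomialMap

theorem lift_mem_polyMaps {σ R : Type*} [Ring R] (w : FreeMonoid σ) (hw : w ≠ 1) :
    (fun v : σ → R => FreeMonoid.lift v w) ∈ polyMaps (σ → R) R w.length := by
  induction w using FreeMonoid.recOn with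
  | one => exact absurd rfl hw
  | of_mul i w ih =>
    by_cases h : w = 1
    · subst h
      rw [mul_one]
      simp only [FreeMonoid.lift_eval_of]
      exact addMonoidHom_mem_polyMaps (Pi.evalAddMonoidHom (fun _ : σ => R) i)
    · rw [FreeMonoid.length_mul, FreeMonoid.length_of, add_comm]
      simpa using mul_mem_polyMaps (Pi.evalAddMonoidHom (fun _ : σ => R) i) (ih h)

end PolynomialMap

/-! ### Coefficients of substitutions, and passage from integers to `G`. -/

namespace NCPolynomial

open PolynomialMap

variable {G : Type*} [AddCommSemigroup G]

theorem coeffMul_apply {τ : Type*} (c : Coeff G) (f : NatPoly τ) (u : FreeMonoid τ) :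
    coeffMul c f u = f.coeff u • c := by
  classical
  rw [coeffMul, Finsupp.finsetSum_apply]
  simp only [Finsupp.single_apply, Finset.sum_ite_eq', Finsupp.mem_support_iff]
  split_ifs with h
  · rfl
  · rw [not_not.1 h, zero_nsmul]

theorem subst_apply {σ τ : Type*} (p : NCPolynomial G σ) (f : σ → NatPoly τ) (u : FreeMonoid τ) :
    p.subst f u = ∑ w ∈ p.support, (FreeMonoid.lift f w).coeff u • p w := by
  simp [subst, Finsupp.finsetSum_apply, coeffMul_apply]

theorem coeff_one_mul {τ : Type*} {f : NatPoly τ} (g : NatPoly τ) (hf : f.coeff 1 = 0) :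
    (f * g).coeff 1 = 0 := by
  classical
  rw [MonoidAlgebra.coeff_mul]
  refine Finset.sum_eq_zero fun a _ => Finset.sum_eq_zero fun b _ => ?_
  rcases eq_or_ne a 1 with rfl | ha
  · simp [hf]
  · refine if_neg fun h => ?_
    have := congrArg FreeMonoid.length h
    rw [FreeMonoid.length_mul, FreeMonoid.length_one] at this
    exact ha (FreeMonoid.length_eq_zero.1 (by omega))

theorem coeff_one_lift {σ τ : Type*} {f : σ → NatPoly τ} (hf : ∀ i, (f i).coeff 1 = 0)
    {w : FreeMonoid σ} (hw : w ≠ 1) : (FreeMonoid.lift f w).coeff 1 = 0 := by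
  induction w using FreeMonoid.casesOn with
  | one => exact absurd rfl hw
  | of_mul i w =>
    rw [map_mul, FreeMonoid.lift_eval_of]
    exact coeff_one_mul _ (hf i)

theorem NoConstantTerm.subst {σ τ : Type*} {p : NCPolynomial G σ} (hp : p.NoConstantTerm)
    {f : σ → NatPoly τ} (hf : ∀ i, (f i).coeff 1 = 0) : (p.subst f).NoConstantTerm := by
  rw [NoConstantTerm, subst_apply]
  refine Finset.sum_eq_zero fun w _ => ?_
  rcases eq_or_ne w 1 with rfl | hw
  · rw [show p 1 = 0 from hp, nsmul_zero]
  · rw [coeff_one_lift hf hw, zero_nsmul]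

theorem coeff_one_sum_natVar {τ ι : Type*} (s : Finset ι) (y : ι → τ) :
    (∑ j ∈ s, (natVar (y j) : NatPoly τ)).coeff 1 = 0 := by
  rw [MonoidAlgebra.coeff_sum, Finsupp.finsetSum_apply]
  refine Finset.sum_eq_zero fun j _ => ?_
  rw [natVar, MonoidAlgebra.of_apply, MonoidAlgebra.coeff_single]
  exact Finsupp.single_eq_of_ne (FreeMonoid.of_ne_one _).symm

/-- Change of variables, together with extension of the coefficients from `ℕ` to `ℤ`. -/
noncomputable def renameInt {τ τ' : Type*} (g : τ → τ') :
    NatPoly τ →+* MonoidAlgebra ℤ (FreeMonoid τ') :=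
  (MonoidAlgebra.mapRingHom _ (Nat.castRingHom ℤ)).comp
    (MonoidAlgebra.mapDomainRingHom ℕ (FreeMonoid.map g))

theorem renameInt_natVar {τ τ' : Type*} (g : τ → τ') (i : τ) :
    renameInt g (natVar i) = MonoidAlgebra.of ℤ _ (FreeMonoid.of (g i)) := by
  simp [renameInt, natVar]

theorem freeMonoid_map_injective {τ τ' : Type*} {g : τ → τ'} (hg : Function.Injective g) :
    Function.Injective (FreeMonoid.map g) :=
  List.map_injective_iff.2 hg

theorem coeff_renameInt {τ τ' : Type*} {g : τ → τ'} (hg : Function.Injective g) (f : NatPoly τ)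
    (u : FreeMonoid τ) : (renameInt g f).coeff (FreeMonoid.map g u) = (f.coeff u : ℤ) := by
  simp [renameInt, Finsupp.mapDomain_apply (freeMonoid_map_injective hg)]

/-- Realize a family of integral polynomials as a polynomial without constant term over `G`:
the `x`-th member, with its negative coefficients cut off and in the variables that come
from `τ`, is multiplied by `c x`. -/
noncomputable def realize {I τ τ' : Type*} {g : τ → τ'} (hg : Function.Injective g)
    (J : Finset I) (c : I → Coeff G) (a : I → FreeMonoid τ' →₀ ℤ) : NCPolynomial G τ :=
  (∑ x ∈ J, ((a x).comapDomain (FreeMonoid.map g) (freeMonoid_map_injective hg).injOn).mapRange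
    (fun z : ℤ => z.toNat • c x) (zero_nsmul _)).erase 1

section realize

variable {I τ τ' : Type*} {g : τ → τ'} (hg : Function.Injective g) (J : Finset I)
  (c : I → Coeff G)

theorem realize_noConstantTerm (a : I → FreeMonoid τ' →₀ ℤ) :
    (realize hg J c a).NoConstantTerm := by
  rw [NoConstantTerm, realize, Finsupp.erase_same]

theorem realize_apply (a : I → FreeMonoid τ' →₀ ℤ) {u : FreeMonoid τ} (hu : u ≠ 1) :
    realize hg J c a u = ∑ x ∈ J, (a x (FreeMonoid.map g u)).toNat • c x := by
  rw [realize, Finsupp.erase_ne hu, Finsupp.finsetSum_apply]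
  rfl

/-- `Int.toNat` is additive only on nonnegative integers, hence the sign hypotheses. -/
theorem realize_add {a b : I → FreeMonoid τ' →₀ ℤ} (ha : ∀ x u, 0 ≤ a x u)
    (hb : ∀ x u, 0 ≤ b x (FreeMonoid.map g u)) :
    realize hg J c (a + b) = realize hg J c a + realize hg J c b := by
  ext u
  rcases eq_or_ne u 1 with rfl | hu
  · have h := fun a => realize_noConstantTerm hg J c a
    simp only [NoConstantTerm] at h
    rw [Finsupp.add_apply, h, h, h, add_zero]
  · rw [Finsupp.add_apply, realize_apply _ _ _ _ hu, realize_apply _ _ _ _ hu,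
      realize_apply _ _ _ _ hu, ← Finset.sum_add_distrib]
    refine Finset.sum_congr rfl fun x _ => ?_
    rw [Pi.add_apply, Finsupp.add_apply, Int.toNat_add (ha _ _) (hb _ _), add_nsmul]

end realize

open Classical in
/-- The polynomial map sending `v` to the family whose entry at `(t, w)` is the value of the
word `w` at `v`, for the words `w` of `s`, and whose other entries vanish. -/
noncomputable def wordMap {T σ τ : Type*} (t : T) (s : Finset (FreeMonoid σ))
    (v : σ → MonoidAlgebra ℤ (FreeMonoid τ)) : T × FreeMonoid σ → FreeMonoid τ →₀ ℤ :=
  ∑ w ∈ s, Pi.single (t, w) (FreeMonoid.lift v w).coeff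

section wordMap

variable {T σ τ : Type*} (t : T) (s : Finset (FreeMonoid σ))

open Classical in
theorem wordMap_apply (v : σ → MonoidAlgebra ℤ (FreeMonoid τ)) (x : T × FreeMonoid σ) :
    wordMap t s v x = if x.1 = t ∧ x.2 ∈ s then (FreeMonoid.lift v x.2).coeff else 0 := by
  obtain ⟨t', w⟩ := x
  simp only [wordMap, Finset.sum_apply, Pi.single_apply, Prod.mk.injEq]
  by_cases h : t' = t
  · simp [h]
  · simp [h]

open Classical in
theorem wordMap_mem_polyMaps (hs : ∀ w ∈ s, w ≠ 1) : ∃ d, wordMap t s ∈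
    polyMaps (σ → MonoidAlgebra ℤ (FreeMonoid τ)) (T × FreeMonoid σ → FreeMonoid τ →₀ ℤ) d := by
  refine ⟨s.sup FreeMonoid.length, ?_⟩
  have : wordMap (τ := τ) t s = ∑ w ∈ s, fun v =>
      ((AddMonoidHom.single (fun _ : T × FreeMonoid σ => FreeMonoid τ →₀ ℤ) (t, w)).comp
        MonoidAlgebra.coeffAddEquiv.toAddMonoidHom) (FreeMonoid.lift v w) := by
    ext v : 1
    rw [Finset.sum_apply]
    rfl
  rw [this]
  exact sum_mem fun w hw => comp_mem_polyMaps _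
    (polyMaps_mono (Finset.le_sup hw) (lift_mem_polyMaps w (hs w hw)))

end wordMap

end NCPolynomial

open NCPolynomial PolynomialMap in
theorem proposition7p3 (r q n : ℕ) {G : Type*} [AddCommSemigroup G]
    (p : Fin q → NCPolynomial G (Fin n)) (hp : ∀ t, (p t).NoConstantTerm) :
    ∃ (N : ℕ) (Q : Finset (NCPolynomial G (Fin n × Fin N))),
      (∀ f ∈ Q, f.NoConstantTerm) ∧
      ∀ χ : Q → Fin r, ∃ γ : Finset (Fin N), γ.Nonempty ∧ ∃ h ∈ Q, ∃ c : Fin r, ∀ t : Fin q,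
        ∃ hmem : h + (p t).subst (fun m => ∑ j ∈ γ, NCPolynomial.natVar (m, j)) ∈ Q,
          χ ⟨h + (p t).subst (fun m => ∑ j ∈ γ, NCPolynomial.natVar (m, j)), hmem⟩ = c := by
  classical
  let P : Fin q → (Fin n → MonoidAlgebra ℤ (FreeMonoid (Fin n × ℕ))) →
      Fin q × FreeMonoid (Fin n) → FreeMonoid (Fin n × ℕ) →₀ ℤ := fun t => wordMap t (p t).support
  have hP : ∀ t, ∃ d, P t ∈ polyMaps _ _ d := fun t => wordMap_mem_polyMaps t _ fun w hw h1 =>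
    Finsupp.mem_support_iff.1 hw (h1 ▸ hp t)
  choose d hd using hP
  have hrec : IsRecurrent (Finset.univ.image P) :=
    isRecurrent_of_mem_polyMaps (D := Finset.univ.sup d) _ fun f hf => by
      obtain ⟨t, -, rfl⟩ := Finset.mem_image.1 hf
      exact polyMaps_mono (Finset.le_sup (Finset.mem_univ t)) (hd t)
  -- Variables are indexed by `ℕ` because `N` is only produced by the recurrence.
  let e : ℕ → Fin n → MonoidAlgebra ℤ (FreeMonoid (Fin n × ℕ)) := fun j i =>
    MonoidAlgebra.of ℤ _ (FreeMonoid.of (i, j))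
  -- The extra colour `none` is for points whose image lies outside `Q₁`, where `χ` is undefined.
  obtain ⟨N, Q, hQ⟩ := hrec (Option (Fin r)) e
  let g : Fin n × Fin N → Fin n × ℕ := Prod.map id Fin.val
  have hg : Function.Injective g := Function.injective_id.prodMap Fin.val_injective
  let J : Finset (Fin q × FreeMonoid (Fin n)) :=
    Finset.univ ×ˢ Finset.univ.biUnion fun t => (p t).support
  let Φ := realize hg J fun x => p x.1 x.2
  let b : Fin q × FreeMonoid (Fin n) → FreeMonoid (Fin n × ℕ) →₀ ℤ := ∑ a ∈ Q, |a|
  have hb : ∀ a ∈ Q, 0 ≤ a + b := by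
    intro a ha
    have h1 : |a| ≤ b := Finset.single_le_sum (f := fun a => |a|) (fun _ _ => abs_nonneg _) ha
    exact neg_le_iff_add_nonneg'.1 ((neg_le_abs a).trans h1)
  let Γ : Finset ℕ → Finset (Fin N) := fun γ => Finset.univ.filter fun j => (j : ℕ) ∈ γ
  have hΓ : ∀ γ ⊆ Finset.range N, (Γ γ).map Fin.valEmbedding = γ := by
    intro γ hγ
    ext j
    simp only [Γ, Finset.mem_map, Finset.mem_filter, Finset.mem_univ, true_and,
      Fin.valEmbedding_apply]
    exact ⟨by rintro ⟨i, hi, rfl⟩; exact hi,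
      fun hj => ⟨⟨j, Finset.mem_range.1 (hγ hj)⟩, hj, rfl⟩⟩
  let y : Finset ℕ → Fin n → NatPoly (Fin n × Fin N) := fun γ m => ∑ j ∈ Γ γ, natVar (m, j)
  have hy : ∀ γ ⊆ Finset.range N, ∀ (w : FreeMonoid (Fin n)) (u : FreeMonoid (Fin n × Fin N)),
      (FreeMonoid.lift (∑ j ∈ γ, e j) w).coeff (FreeMonoid.map g u) =
        ((FreeMonoid.lift (y γ) w).coeff u : ℤ) := by
    intro γ hγ w u
    rw [← coeff_renameInt hg]
    have : renameInt g (FreeMonoid.lift (y γ) w) = FreeMonoid.lift (renameInt g ∘ y γ) w :=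
      FreeMonoid.hom_map_lift (renameInt g).toMonoidHom _ _
    rw [this]
    congr 3
    ext1 m
    conv_lhs => rw [← hΓ γ hγ]
    simp [y, e, renameInt_natVar, g]
  have hPnonneg : ∀ t, ∀ γ ⊆ Finset.range N, ∀ x u,
      0 ≤ P t (∑ j ∈ γ, e j) x (FreeMonoid.map g u) := by
    intro t γ hγ x u
    simp only [P, wordMap_apply]
    split_ifs
    · rw [hy γ hγ]
      exact Int.natCast_nonneg _
    · exact le_rfl
  have hΦP : ∀ t, ∀ γ ⊆ Finset.range N, Φ (P t (∑ j ∈ γ, e j)) = (p t).subst (y γ) := by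
    intro t γ hγ
    ext u
    rcases eq_or_ne u 1 with rfl | hu
    · exact (realize_noConstantTerm hg J _ _).trans
        ((hp t).subst fun i => coeff_one_sum_natVar _ _).symm
    · rw [realize_apply _ _ _ _ hu, subst_apply, Finset.sum_product,
        Finset.sum_eq_single t (fun t' _ ht => Finset.sum_eq_zero fun w _ => ?_)
          (fun h => absurd (Finset.mem_univ t) h)]
      · refine (Finset.sum_subset_zero_on_sdiff (Finset.subset_biUnion_of_mem
          (fun t => (p t).support) (Finset.mem_univ t)) (fun w hw => ?_) fun w hw => ?_).symm
        · rw [Finsupp.notMem_support_iff.1 (Finset.mem_sdiff.1 hw).2, nsmul_zero]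
        · simp only [P, wordMap_apply]
          simp only [hw, and_self, if_true]
          rw [hy γ hγ, Int.toNat_natCast]
      · simp only [P, wordMap_apply]
        rw [if_neg fun h => ht h.1]
        simp
  have hadd : ∀ t, ∀ γ ⊆ Finset.range N, ∀ a ∈ Q,
      Φ (a + P t (∑ j ∈ γ, e j) + b) = Φ (a + b) + (p t).subst (y γ) := by
    intro t γ hγ a ha
    rw [← hΦP t γ hγ, add_right_comm]
    exact realize_add hg J _ (fun x u => hb a ha x u) (hPnonneg t γ hγ)
  -- All translates are included, since `a` and `γ` depend on the colouring.
  let Q₁ : Finset (NCPolynomial G (Fin n × Fin N)) :=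
    (Q ∪ (Q ×ˢ (Finset.univ ×ˢ (Finset.range N).powerset)).image
      fun x => x.1 + P x.2.1 (∑ j ∈ x.2.2, e j)).image fun a => Φ (a + b)
  refine ⟨N, Q₁, fun f hf => ?_, fun χ => ?_⟩
  · obtain ⟨a, -, rfl⟩ := Finset.mem_image.1 hf
    exact realize_noConstantTerm hg J _ _
  obtain ⟨a, ha, γ, hγ, hγ0, hc⟩ := hQ fun a =>
    if h : Φ (a + b) ∈ Q₁ then some (χ ⟨Φ (a + b), h⟩) else none
  have ha₁ : Φ (a + b) ∈ Q₁ :=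
    Finset.mem_image_of_mem (fun a => Φ (a + b)) (Finset.mem_union_left _ ha)
  refine ⟨Γ γ, Finset.map_nonempty.1 ((hΓ γ hγ).symm ▸ hγ0), Φ (a + b), ha₁,
    χ ⟨_, ha₁⟩, fun t => ?_⟩
  have hmem : Φ (a + P t (∑ j ∈ γ, e j) + b) ∈ Q₁ :=
    Finset.mem_image_of_mem (fun a => Φ (a + b)) (Finset.mem_union_right _
      (Finset.mem_image.2 ⟨(a, t, γ), by simp [ha, hγ], rfl⟩))
  have hct := hc (P t) (Finset.mem_image_of_mem P (Finset.mem_univ t))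
  rw [dif_pos ha₁, dif_pos hmem, Option.some_inj] at hct
  simp only [hadd t γ hγ a ha] at hct hmem
  exact ⟨hmem, hct⟩
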